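/- **Theorem 1.2 (Stability under SPK).** Let $d\ge 1$ and let $\mu,\nu$ be Borel probability measures on $\mathbb R^d$ with finite second moments. For $\theta\in\mathbb S^{d-1}$ write $\pi_\theta(x)=\theta\cdot x$ and $\mu_\theta=(\pi_\theta)_\#\mu$, let $\sigma$ be the normalized surface measure on $\mathbb S^{d-1}$, and put $$\mathcal D(\mu,\nu)=\frac1d W_2^2(\mu,\nu)-\int_{\mathbb S^{d-1}}W_2^2(\mu_\theta,\nu_\theta)\,d\sigma(\theta),$$ where $W_2$ is the quadratic Wasserstein distance. Let $\mathcal A_d=\{x\mapsto\lambda x+b:\lambda\in\mathbb R,\ b\in\mathbb R^d\}$ and let $\mathrm{Tan}_\mu$ be the closure of $\{\nabla f: f\in C_c^\infty(\mathbb R^d)\}$ in $L^2(\mu;\mathbb R^d)$. For $u\in L^2(\mu;\mathbb R^d)$ and $X\sim\mu$ put $$\mathcal R_\mu(u)=\int_{\mathbb S^{d-1}}\mathbb E_\mu\bigl[\operatorname{Var}(\theta\cdot u(X)\mid\theta\cdot X)\bigr]\,d\sigma(\theta),$$ and define $$\kappa_{\mathrm{SPK}}(\mu)=\inf\left\{\frac{\mathcal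 R_\mu(u)}{\operatorname{dist}^2_{L^2(\mu)}(u,\mathcal A_d)}:\ u\in\mathrm{Tan}_\mu,\ \operatorname{dist}_{L^2(\mu)}(u,\mathcal A_d)>0\right\}\in[0,\infty],\qquad \overline\kappa_{\mathrm{SPK}}(\mu)=d\,\kappa_{\mathrm{SPK}}(\mu)$$ (with $\inf\emptyset=\infty$ and $c/\infty=0$ for $0\le c<\infty$). Assume that $\mu$ is absolutely continuous with respect to Lebesgue measure, and let $T=\nabla\varphi$ be the Brenier map from $\mu$ to $\nu$, that is, $T_\#\mu=\nu$ and $T$ is $\mu$-a.e. the gradient of a convex function $\varphi$ (finite on an open convex set of full $\mu$-measure). Assume $T\in\mathrm{Tan}_\mu$. For $\sigma$-a.e. $\theta$ let $\tau_\theta$ be the monotone transport map from $\mu_\theta$ to $\nu_\theta$ (determined $\mu_\theta$-a.e.), and suppose that $$\Lambda:=\operatorname*{ess\,sup}_{\theta\in\mathbb S^{d-1}}\operatorname{Lip}(\tau_\theta)<\infty,$$ where $\operatorname{Lip}(\tau_\theta)$ is the least $K\in[0,\infty]$ such that $\tau_\theta$ is $K$-Lipschitz on a set of full $\mu_\theta$-measure.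 If $\kappa_{\mathrm{SPK}}(\mu)>0$, then $$\operatorname{dist}^2_{L^2(\mu)}(T,\mathcal A_d)\le\frac{\Lambda}{\kappa_{\mathrm{SPK}}(\mu)}\,\mathcal D(\mu,\nu),$$ and equivalently $$\operatorname{dist}^2_{L^2(\mu)}(T,\mathcal A_d)\le\frac{d\,\Lambda}{\overline\kappa_{\mathrm{SPK}}(\mu)}\,\mathcal D(\mu,\nu).$$ -/

import Mathlib

open MeasureTheory ProbabilityTheory
open scoped NNReal ENNReal ContDiff

noncomputable section

namespace SlicedPK

/-- The set `Π(μ, ν)` of transport plans from `μ` to `ν`. -/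
def plans {X : Type*} [MeasurableSpace X] (μ ν : Measure X) : Set (Measure (X × X)) :=
  {γ | γ.map Prod.fst = μ ∧ γ.map Prod.snd = ν}

/-- The squared quadratic Wasserstein distance `W₂²(μ, ν)`, as an element of `[0, ∞]`. -/
def W2sq {X : Type*} [MeasurableSpace X] [PseudoEMetricSpace X] (μ ν : Measure X) : ℝ≥0∞ :=
  ⨅ γ ∈ plans μ ν, ∫⁻ p, edist p.1 p.2 ^ 2 ∂γ

/-- Euclidean space `ℝ^d`. -/
abbrev E (d : ℕ) : Type := EuclideanSpace ℝ (Fin d)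

/-- The unit sphere `S^{d-1}`. -/
abbrev S (d : ℕ) : Type := Metric.sphere (0 : E d) 1

/-- The normalized surface measure `σ` on `S^{d-1}`. -/
def sphereMeasure (d : ℕ) : Measure (S d) :=
  ((volume : Measure (E d)).toSphere Set.univ)⁻¹ • (volume : Measure (E d)).toSphere

/-- The projection `π_θ(x) = θ · x`. -/
def proj {d : ℕ} (θ : S d) (x : E d) : ℝ := inner ℝ (θ : E d) x

/-- The projected measure `μ_θ = (π_θ)_# μ`. -/
def slice {d : ℕ} (μ : Measure (E d)) (θ : S d) : Measure ℝ := μ.map (proj θ)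

/-- The squared sliced Wasserstein distance `SW₂²(μ, ν)`. -/
def SW2sq {d : ℕ} (μ ν : Measure (E d)) : ℝ≥0∞ :=
  ∫⁻ θ, W2sq (slice μ θ) (slice ν θ) ∂(sphereMeasure d)

/-- The sliced Wasserstein deficit `D(μ, ν) = W₂²(μ, ν) / d - SW₂²(μ, ν)`, for measures with
finite second moments (so that both terms are finite). -/
def deficit {d : ℕ} (μ ν : Measure (E d)) : ℝ :=
  1 / (d : ℝ) * (W2sq μ ν).toReal - (SW2sq μ ν).toReal

/-- The ridge defect `R_μ(u) = ∫ E_μ[Var(θ · u(X) | θ · X)] dσ(θ)`; the conditioning is on the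
σ-algebra on `ℝ^d` generated by `π_θ`. -/
def ridgeDefect {d : ℕ} (μ : Measure (E d)) (u : E d → E d) : ℝ≥0∞ :=
  ∫⁻ θ, ENNReal.ofReal
    (∫ x, condVar (MeasurableSpace.comap (proj θ) inferInstance) (fun y => proj θ (u y)) μ x ∂μ)
    ∂(sphereMeasure d)

/-- The family `A_d = {x ↦ λ x + b}`, as a subset of `L²(μ; ℝ^d)`. -/
def affineFields {d : ℕ} (μ : Measure (E d)) : Set (Lp (E d) 2 μ) :=
  {v | ∃ (l : ℝ) (b : E d), v =ᵐ[μ] fun x => l • x + b}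

/-- The tangent space `Tan_μ`: the closure in `L²(μ; ℝ^d)` of the gradients of smooth compactly
supported functions. -/
def tangentSpace {d : ℕ} (μ : Measure (E d)) : Set (Lp (E d) 2 μ) :=
  closure {v | ∃ f : E d → ℝ, ContDiff ℝ ∞ f ∧ HasCompactSupport f ∧
    v =ᵐ[μ] fun x => gradient f x}

/-- The sliced Poincaré–Korn constant: the infimum of `R_μ(u) / dist²(u, A_d)` over those
`u ∈ Tan_μ` that have positive distance from `A_d` (with the value `∞` if there are none). -/
def kappaSPK {d : ℕ} (μ : Measure (E d)) : ℝ≥0∞ :=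
  ⨅ (u : Lp (E d) 2 μ) (_ : u ∈ tangentSpace μ) (_ : 0 < Metric.infDist u (affineFields μ)),
    ridgeDefect μ u / ENNReal.ofReal (Metric.infDist u (affineFields μ) ^ 2)

/-- The normalized sliced Poincaré–Korn constant `d κ_SPK(μ)`. -/
def kappaSPKbar {d : ℕ} (μ : Measure (E d)) : ℝ≥0∞ := (d : ℝ≥0∞) * kappaSPK μ

/-- `T = ∇φ` is the Brenier map from `μ` to `ν`: `T` pushes `μ` forward to `ν` and is `μ`-a.e. the
gradient of the convex function `φ`. As usual `φ` may take the value `+∞` away from an open convex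
set `Ω` (the interior of its domain) of full measure; only its values on `Ω` are used. -/
structure IsBrenierMap {d : ℕ} (μ ν : Measure (E d)) (φ : E d → ℝ) (T : E d → E d) : Prop where
  aemeasurable : AEMeasurable T μ
  map_eq : μ.map T = ν
  exists_convex : ∃ Ω : Set (E d), IsOpen Ω ∧ μ Ωᶜ = 0 ∧ ConvexOn ℝ Ω φ ∧
    ∀ᵐ x ∂μ, HasGradientAt φ (T x) x

/-- `t` is the monotone transport map from `α` to `β` on the line: it is nondecreasing on a set of
full `α`-measure and pushes `α` forward to `β`. -/
structure IsMonotoneTransport (α β : Measure ℝ) (t : ℝ → ℝ) : Prop where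
  aemeasurable : AEMeasurable t α
  map_eq : α.map t = β
  monotoneOn : ∃ s ∈ ae α, MonotoneOn t s

/-- The Lipschitz constant in `[0, ∞]` of a map that is defined up to `α`-null sets: the least `K`
such that the map is `K`-Lipschitz on a set of full `α`-measure. -/
def essLip (α : Measure ℝ) (t : ℝ → ℝ) : ℝ≥0∞ :=
  ⨅ (K : ℝ≥0) (_ : ∃ s ∈ ae α, LipschitzOnWith K t s), (K : ℝ≥0∞)

end SlicedPK

end

/-!
The theorem is the chain `κ · dist²(T, A_d) ≤ R_μ(T) ≤ Λ · D(μ, ν)`. The first inequality is the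
definition of `κ_SPK(μ)`, with `T` as a competitor. The second, `ridgeDefect_le_mul_deficit`, is
obtained one direction at a time.

For a unit vector `θ` put `X = θ · x`, `Y = θ · T(x)` and `Z = τ_θ(X)`. The measure on the sphere is
isotropic (`lintegral_enorm_proj_sq`) and `T` is optimal (`IsBrenierMap.lintegral_le_W2sq`), so
`W₂²(μ, ν) / d` is the average over `θ` of `E|Y - X|²`. On the other hand
`W₂²(μ_θ, ν_θ) ≤ E|Z - X|²`. Hence it suffices that, for `K > Λ`,
`K E|Z - X|² + E|Y - Z|² ≤ K E|Y - X|²`, because `Z` is a function of `X` and so `E|Y - Z|²` is at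
least `E Var(Y | X)`; this is `mul_W2sq_add_integral_condVar_le`.

As `Y` and `Z` have the same law, expanding the squares turns the last inequality into
`E[(K X - Z) Y] ≤ E[(K X - Z) Z]`. Both `K x - τ_θ(x)` and `τ_θ(x)` are nondecreasing in `x`, so `Z`
is a subgradient at `K X - Z` of a convex potential
(`exists_potential_of_monotoneOn_lipschitzOnWith`), and the inequality says that a coupling
supported on a subdifferential maximizes the correlation. This is
`integral_inner_le_of_subgradient`, proved by means of the convex conjugate; the optimality of the
Brenier map is another instance of it.
-/

namespace SlicedPK

open Set Filter Topology

/-! ### Convex functions and monotone Lipschitz functions -/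

/-- The gradient of a convex function at a point is a subgradient there. -/
lemma add_inner_le_of_convexOn_of_hasGradientAt {H : Type*} [NormedAddCommGroup H]
    [InnerProductSpace ℝ H] [CompleteSpace H] {s : Set H} {f : H → ℝ} (hf : ConvexOn ℝ s f)
    {x z g : H} (hx : x ∈ s) (hz : z ∈ s) (hg : HasGradientAt f g x) :
    f x + inner ℝ g (z - x) ≤ f z := by
  have hq := hf.comp_affineMap (AffineMap.lineMap x z : ℝ →ᵃ[ℝ] H)
  have hd : HasDerivAt (f ∘ (AffineMap.lineMap x z : ℝ →ᵃ[ℝ] H)) (inner ℝ g (z - x)) 0 := by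
    have h1 : HasDerivAt (AffineMap.lineMap x z : ℝ →ᵃ[ℝ] H) (z - x) (0 : ℝ) :=
      AffineMap.hasDerivAt_lineMap
    have h2 : HasFDerivAt f ((InnerProductSpace.toDual ℝ H) g)
        ((AffineMap.lineMap x z : ℝ →ᵃ[ℝ] H) 0) := by
      simpa using hg.hasFDerivAt
    simpa using h2.comp_hasDerivAt (0 : ℝ) h1
  have h := hq.le_slope_of_hasDerivAt (by simpa using hx) (by simpa using hz) zero_lt_one hd
  simp only [slope_def_field, Function.comp_apply, AffineMap.lineMap_apply_one,
    AffineMap.lineMap_apply_zero, sub_zero, div_one] at h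
  linarith

lemma add_mul_sub_le_of_hasDerivAt_of_monotone {f f' : ℝ → ℝ} (hf : ∀ x, HasDerivAt f (f' x) x)
    (hf' : Monotone f') (x z : ℝ) : f x + f' x * (z - x) ≤ f z := by
  have hd : deriv f = f' := funext fun x => (hf x).deriv
  have hc : ConvexOn ℝ univ f :=
    Monotone.convexOn_univ_of_deriv (fun x => (hf x).differentiableAt) (hd ▸ hf')
  have hg : HasGradientAt f (f' x) x := by
    simpa using (hf x).hasGradientAt
  have := add_inner_le_of_convexOn_of_hasGradientAt hc (mem_univ x) (mem_univ z) hg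
  simpa [mul_comm] using this

/-- A function that is nondecreasing and `K`-Lipschitz on a subset of the line extends to the whole
line with both properties. -/
lemma exists_monotone_lipschitzWith_eqOn {s : Set ℝ} {t : ℝ → ℝ} {K : ℝ≥0}
    (hm : MonotoneOn t s) (hl : LipschitzOnWith K t s) :
    ∃ g : ℝ → ℝ, Monotone g ∧ LipschitzWith K g ∧ EqOn t g s := by
  rcases s.eq_empty_or_nonempty with rfl | ⟨x₀, hx₀⟩
  · exact ⟨fun _ => 0, monotone_const, LipschitzWith.const' 0, by simp⟩
  have : Nonempty s := ⟨⟨x₀, hx₀⟩⟩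
  have hK : (0 : ℝ) ≤ K := K.2
  have key : ∀ p ∈ s, ∀ x ∈ s, t p - K * max (p - x) 0 ≤ t x := by
    intro p hp x hx
    rcases le_total p x with h | h
    · rw [max_eq_right (by linarith)]
      linarith [hm hp hx h]
    · rw [max_eq_left (by linarith)]
      have := hl.dist_le_mul p hp x hx
      rw [Real.dist_eq, Real.dist_eq, abs_of_nonneg (sub_nonneg.2 h)] at this
      linarith [le_abs_self (t p - t x)]
  have shift : ∀ p x y : ℝ, t p - K * max (p - x) 0 ≤ t p - K * max (p - y) 0 + K * |x - y| := by
    intro p x y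
    have : max (p - y) 0 ≤ max (p - x) 0 + |x - y| := by
      apply max_le
      · linarith [le_max_left (p - x) 0, le_abs_self (x - y)]
      · positivity
    nlinarith [mul_le_mul_of_nonneg_left this hK]
  have bdd : ∀ x, BddAbove (range fun p : s => t p - K * max ((p : ℝ) - x) 0) := by
    intro x
    refine ⟨t x₀ + K * |x - x₀|, ?_⟩
    rintro _ ⟨p, rfl⟩
    linarith [shift p x x₀, key p p.2 x₀ hx₀]
  refine ⟨fun x => ⨆ p : s, (t p - K * max ((p : ℝ) - x) 0), ?_, ?_, ?_⟩
  · intro x y hxy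
    refine ciSup_mono (bdd y) fun p => ?_
    gcongr
  · refine LipschitzWith.of_le_add_mul K fun x y => ?_
    refine ciSup_le fun p => ?_
    rw [Real.dist_eq]
    linarith [shift p x y, le_ciSup (bdd y) p]
  · intro x hx
    refine le_antisymm ?_ (ciSup_le fun p => key p p.2 x hx)
    simpa using le_ciSup (bdd x) ⟨x, hx⟩

/-- If `t` is nondecreasing and `K`-Lipschitz, then `x ↦ (K x - t x, t x)` parametrizes a subset of
the graph of the subdifferential of a convex function. The potential is `K h - t² / 2`, where `h` is
a primitive of (an extension of) `t`. -/
lemma exists_potential_of_monotoneOn_lipschitzOnWith {s : Set ℝ} {t : ℝ → ℝ} {K : ℝ≥0} (hK : 0 < K)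
    (hm : MonotoneOn t s) (hl : LipschitzOnWith K t s) :
    ∃ ψ : ℝ → ℝ, ∀ x ∈ s, ∀ y ∈ s, ψ x + t x * ((K * y - t y) - (K * x - t x)) ≤ ψ y := by
  obtain ⟨g, gm, gl, hg⟩ := exists_monotone_lipschitzWith_eqOn hm hl
  have hK' : (0 : ℝ) < K := hK
  let h : ℝ → ℝ := fun x => ∫ u in (0 : ℝ)..x, g u
  have hh : ∀ x, HasDerivAt h (g x) x := fun x =>
    intervalIntegral.integral_hasDerivAt_right (gl.continuous.intervalIntegrable _ _)
      (gl.continuous.stronglyMeasurableAtFilter _ _) gl.continuous.continuousAt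
  -- `K x² / 2 - h` is convex too, because `g` is `K`-Lipschitz.
  have hh' : ∀ x, HasDerivAt (fun u => K / 2 * u ^ 2 - h u) (K * x - g x) x := fun x => by
    refine ((((hasDerivAt_id x).pow 2).const_mul (K / 2 : ℝ)).sub (hh x)).congr_deriv ?_
    simp only [id]
    ring
  have gm' : Monotone fun x => K * x - g x := by
    intro x y hxy
    have := gl.dist_le_mul y x
    rw [Real.dist_eq, Real.dist_eq, abs_of_nonneg (sub_nonneg.2 hxy)] at this
    linarith [le_abs_self (g y - g x)]
  have smooth : ∀ x y, (g y - g x) ^ 2 / 2 ≤ K * (h y - h x - g x * (y - x)) := by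
    intro x y
    -- The minimizer of the quadratic upper bound at `y` of `h - g x • id`.
    set z := y - (g y - g x) / K with hz
    have h1 := add_mul_sub_le_of_hasDerivAt_of_monotone hh gm x z
    have h2 := add_mul_sub_le_of_hasDerivAt_of_monotone hh' gm' y z
    have h3 : g y - g x = K * (y - z) := by rw [hz]; field_simp; ring
    have h4 : K / 2 * (y - z) ^ 2 ≤ h y - h x - g x * (y - x) := by
      nlinarith [congrArg (· * (y - z)) h3]
    rw [h3]
    nlinarith [mul_le_mul_of_nonneg_left h4 hK'.le]
  refine ⟨fun x => K * h x - g x ^ 2 / 2, fun x hx y hy => ?_⟩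
  rw [hg hx, hg hy]
  nlinarith [smooth x y]

/-! ### Optimality of couplings supported on a subdifferential -/

lemma integrable_inner_of_memLp_two {Ω H : Type*} [MeasurableSpace Ω] [NormedAddCommGroup H]
    [InnerProductSpace ℝ H] {P : Measure Ω} {X Y : Ω → H} (hX : MemLp X 2 P) (hY : MemLp Y 2 P) :
    Integrable (fun w => inner ℝ (X w) (Y w)) P :=
  (hX.norm.integrable_mul hY.norm).mono' (hX.1.inner hY.1)
    (Eventually.of_forall fun w => norm_inner_le_norm (X w) (Y w))

/-- If almost surely `T w` is a subgradient at `X w` of a function `ψ` of `X` (written as a function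
on the probability space), then among all `Y` with the law of `T`, the correlation with `X` is
largest for `Y = T`. The function `ψ` is neither assumed measurable nor integrable. -/
theorem integral_inner_le_of_subgradient {Ω H : Type*} [MeasurableSpace Ω] [NormedAddCommGroup H]
    [InnerProductSpace ℝ H] [MeasurableSpace H] [BorelSpace H]
    {P : Measure Ω} [IsProbabilityMeasure P] {X T Y : Ω → H} (hX : MemLp X 2 P)
    (hT : MemLp T 2 P) (hYT : IdentDistrib Y T P P) {A : Set Ω} (hA : A ∈ ae P) (ψ : Ω → ℝ)
    (hψ : ∀ w ∈ A, ∀ w' ∈ A, ψ w + inner ℝ (T w) (X w' - X w) ≤ ψ w') :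
    ∫ w, inner ℝ (X w) (Y w) ∂P ≤ ∫ w, inner ℝ (X w) (T w) ∂P := by
  have hY : MemLp Y 2 P := hYT.symm.memLp_snd hT
  obtain ⟨w₀, hw₀⟩ : A.Nonempty := nonempty_of_mem hA
  -- The convex conjugate of `ψ`.
  let c : H → EReal := fun y => ⨆ w ∈ A, ((inner ℝ (X w) y - ψ w : ℝ) : EReal)
  have hc : Measurable c := by
    refine LowerSemicontinuous.measurable (lowerSemicontinuous_biSup fun w _ => ?_)
    exact (continuous_coe_real_ereal.comp (by fun_prop)).lowerSemicontinuous
  have hcT : ∀ w ∈ A, c (T w) = ((inner ℝ (X w) (T w) - ψ w : ℝ) : EReal) := by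
    intro w hw
    refine le_antisymm (iSup₂_le fun w' hw' => ?_) (le_iSup₂_of_le w hw le_rfl)
    have := hψ w hw w' hw'
    rw [inner_sub_right, real_inner_comm, real_inner_comm (X w)] at this
    exact EReal.coe_le_coe_iff.2 (by linarith)
  have hcY : ∀ᵐ w ∂P, c (Y w) ≠ ⊤ := by
    refine hYT.symm.ae_snd (p := fun y => c y ≠ ⊤) (hc (measurableSet_singleton ⊤).compl) ?_
    filter_upwards [hA] with w hw
    rw [hcT w hw]
    exact EReal.coe_ne_top _
  let r : H → ℝ := fun y => (c y).toReal
  have hr : Measurable r := hc.ereal_toReal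
  have hrT : ∀ w ∈ A, r (T w) = inner ℝ (X w) (T w) - ψ w := fun w hw => by
    simp only [r, hcT w hw, EReal.toReal_coe]
  have hid : IdentDistrib (fun w => r (Y w)) (fun w => r (T w)) P P := hYT.comp hr
  have iXT := integrable_inner_of_memLp_two hX hT
  have iXY := integrable_inner_of_memLp_two hX hY
  -- Both the conjugate and `ψ` have affine lower bounds, and their sum is integrable.
  have irT : Integrable (fun w => r (T w)) P := by
    refine integrable_of_le_of_le (g₁ := fun w => inner ℝ (X w₀) (T w) - ψ w₀)
      (g₂ := fun w => inner ℝ (X w) (T w) - (ψ w₀ + inner ℝ (T w₀) (X w - X w₀)))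
      hid.aemeasurable_snd.aestronglyMeasurable ?_ ?_ ?_ ?_
    · filter_upwards [hA] with w hw
      rw [hrT w hw]
      have := hψ w hw w₀ hw₀
      rw [inner_sub_right, real_inner_comm, real_inner_comm (X w)] at this
      linarith
    · filter_upwards [hA] with w hw
      rw [hrT w hw]
      linarith [hψ w₀ hw₀ w hw]
    · exact ((hT.const_inner (X w₀)).integrable one_le_two).sub (integrable_const _)
    · exact iXT.sub ((integrable_const _).add
        (((hX.sub (memLp_const _)).const_inner (T w₀)).integrable one_le_two))
  have irY : Integrable (fun w => r (Y w)) P := hid.symm.integrable_snd irT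
  have hle : ∫ w, inner ℝ (X w) (Y w) ∂P ≤
      ∫ w, (r (Y w) + (inner ℝ (X w) (T w) - r (T w))) ∂P := by
    refine integral_mono_ae iXY (irY.add (iXT.sub irT)) ?_
    filter_upwards [hA, hcY] with w hw hwY
    have h1 : ((inner ℝ (X w) (Y w) - ψ w : ℝ) : EReal) ≤ c (Y w) := le_iSup₂_of_le w hw le_rfl
    have h2 : inner ℝ (X w) (Y w) - ψ w ≤ r (Y w) :=
      EReal.toReal_le_toReal h1 (EReal.coe_ne_bot _) hwY
    rw [hrT w hw]
    linarith
  have hadd : ∫ w, (r (Y w) + (inner ℝ (X w) (T w) - r (T w))) ∂P =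
      ∫ w, r (Y w) ∂P + ∫ w, (inner ℝ (X w) (T w) - r (T w)) ∂P :=
    integral_add irY (iXT.sub irT)
  rw [hadd, integral_sub iXT irT, hid.integral_eq] at hle
  linarith

/-! ### Conditional variance -/

/-- The conditional mean is the best approximation in mean square. -/
lemma integral_condVar_le_integral_sub_sq {Ω : Type*} {m m₀ : MeasurableSpace Ω} (hm : m ≤ m₀)
    {P : Measure[m₀] Ω} [IsFiniteMeasure P] {Y g : Ω → ℝ} (hY : MemLp Y 2 P) (hg : MemLp g 2 P)
    (hgm : AEStronglyMeasurable[m] g P) :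
    ∫ w, condVar m Y P w ∂P ≤ ∫ w, (Y w - g w) ^ 2 ∂P := by
  have h1 : condVar m Y P =ᵐ[P] condVar m (Y - g) P := by
    refine condExp_congr_ae ?_
    filter_upwards [condExp_sub (m := m) (hY.integrable one_le_two) (hg.integrable one_le_two),
      condExp_of_aestronglyMeasurable' hm hgm (hg.integrable one_le_two)] with w h2 h3
    simp only [Pi.pow_apply, Pi.sub_apply] at h2 ⊢
    rw [h2, h3]
    ring
  calc ∫ w, condVar m Y P w ∂P = ∫ w, condVar m (Y - g) P w ∂P := integral_congr_ae h1
    _ ≤ ∫ w, (P[(Y - g) ^ 2 | m]) w ∂P :=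
      integral_mono_ae integrable_condVar integrable_condExp
        (condVar_ae_le_condExp_sq hm (hY.sub hg))
    _ = ∫ w, (Y w - g w) ^ 2 ∂P := integral_condExp hm

open scoped Pointwise

/-! ### Second moments of the uniform measure on the sphere -/

instance isProbabilityMeasure_sphereMeasure {d : ℕ} [NeZero d] :
    IsProbabilityMeasure (sphereMeasure d) := by
  refine ⟨?_⟩
  have : Nonempty (Fin d) := ⟨0⟩
  rw [sphereMeasure, Measure.smul_apply, smul_eq_mul]
  refine ENNReal.inv_mul_cancel ?_ (measure_ne_top _ _)
  rw [Ne, Measure.measure_univ_eq_zero]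
  exact Measure.toSphere_ne_zero _

/-- The action of a linear isometry on the unit sphere. -/
noncomputable def sphereMap {d : ℕ} (e : E d ≃ₗᵢ[ℝ] E d) (θ : S d) : S d := ⟨e θ, by simp⟩

lemma measurable_sphereMap {d : ℕ} (e : E d ≃ₗᵢ[ℝ] E d) : Measurable (sphereMap e) :=
  (e.continuous.measurable.comp measurable_subtype_coe).subtype_mk

lemma measurePreserving_sphereMap {d : ℕ} (e : E d ≃ₗᵢ[ℝ] E d) :
    MeasurePreserving (sphereMap e) (sphereMeasure d) (sphereMeasure d) := by
  refine MeasurePreserving.smul_measure ⟨measurable_sphereMap e, ?_⟩ _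
  ext s hs
  rw [Measure.map_apply (measurable_sphereMap e) hs, Measure.toSphere_apply' _ hs,
    Measure.toSphere_apply' _ (measurable_sphereMap e hs)]
  have h : Ioo (0 : ℝ) 1 • (Subtype.val '' (sphereMap e ⁻¹' s)) =
      e ⁻¹' (Ioo (0 : ℝ) 1 • (Subtype.val '' s)) := by
    ext x
    simp only [Set.mem_smul, mem_image, mem_preimage]
    constructor
    · rintro ⟨r, hr, _, ⟨θ, hθ, rfl⟩, rfl⟩
      exact ⟨r, hr, _, ⟨_, hθ, rfl⟩, by simp [sphereMap]⟩
    · rintro ⟨r, hr, _, ⟨θ, hθ, rfl⟩, hx⟩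
      refine ⟨r, hr, _, ⟨sphereMap e.symm θ, ?_, rfl⟩, ?_⟩
      · convert hθ
        ext1
        simp [sphereMap]
      · simp only [sphereMap]
        rw [← map_smul, hx, e.symm_apply_apply]
  rw [h]
  congr 1
  exact e.measurePreserving.measure_preimage_equiv (f := e.toMeasurableEquiv) _

/-- The uniform measure on the sphere is isotropic. -/
theorem lintegral_enorm_proj_sq {d : ℕ} [NeZero d] (v : E d) :
    ∫⁻ θ, ‖proj θ v‖ₑ ^ 2 ∂(sphereMeasure d) = (d : ℝ≥0∞)⁻¹ * ‖v‖ₑ ^ 2 := by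
  let G : E d → ℝ≥0∞ := fun v => ∫⁻ θ, ‖proj θ v‖ₑ ^ 2 ∂(sphereMeasure d)
  have hmeas : ∀ v : E d, Measurable fun θ : S d => ‖proj θ v‖ₑ ^ 2 := fun v => by
    unfold proj
    fun_prop
  have hsmul : ∀ (c : ℝ) (v : E d), G (c • v) = ‖c‖ₑ ^ 2 * G v := fun c v => by
    simp only [G, proj, inner_smul_right, enorm_mul, mul_pow]
    exact lintegral_const_mul _ (hmeas v)
  have hiso : ∀ (e : E d ≃ₗᵢ[ℝ] E d) (v : E d), G (e v) = G v := fun e v => by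
    simp only [G]
    rw [← (measurePreserving_sphereMap e).lintegral_comp (hmeas (e v))]
    simp only [proj, sphereMap, LinearIsometryEquiv.inner_map_map]
  have hnorm : ∀ v w : E d, ‖v‖ = ‖w‖ → G v = G w := fun v w h => by
    rw [← Submodule.reflection_sub h, hiso]
  let b : Fin d → E d := fun i => EuclideanSpace.single i 1
  have hb : ∀ i, ‖b i‖ = 1 := fun i => by simp [b]
  have hG : ∀ v i, G v = ‖v‖ₑ ^ 2 * G (b i) := fun v i => by
    rw [hnorm v (‖v‖ • b i) (by simp [norm_smul, hb]), hsmul, enorm_norm]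
  have hsum : ∑ i, G (b i) = 1 := by
    simp only [G]
    rw [← lintegral_finsetSum _ fun i _ => hmeas (b i)]
    have : ∀ θ : S d, ∑ i, ‖proj θ (b i)‖ₑ ^ 2 = 1 := fun θ => by
      have h1 : ∀ i, ‖proj θ (b i)‖ₑ ^ 2 = ENNReal.ofReal (‖(θ : E d) i‖ ^ 2) := fun i => by
        rw [ENNReal.ofReal_pow (norm_nonneg _), ofReal_norm]
        simp [proj, b, EuclideanSpace.inner_single_right]
      simp_rw [h1]
      rw [← ENNReal.ofReal_sum_of_nonneg fun _ _ => by positivity, ← EuclideanSpace.norm_sq_eq]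
      simp
    simp [this]
  have h0 : (d : ℝ≥0∞) * G (b 0) = 1 := by
    rw [← hsum, Finset.sum_congr rfl fun i _ => hnorm (b i) (b 0) (by simp [hb])]
    simp
  change G v = _
  rw [hG v 0, ENNReal.eq_inv_of_mul_eq_one_left ((mul_comm _ _).trans h0), mul_comm]

/-! ### Optimality of the Brenier map and of monotone transport -/

lemma lintegral_enorm_sq {Ω F : Type*} [MeasurableSpace Ω] [NormedAddCommGroup F] {P : Measure Ω}
    {f : Ω → F} (hf : MemLp f 2 P) :
    ∫⁻ w, ‖f w‖ₑ ^ 2 ∂P = ENNReal.ofReal (∫ w, ‖f w‖ ^ 2 ∂P) := by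
  rw [ofReal_integral_eq_lintegral_ofReal hf.norm.integrable_sq
    (ae_of_all _ fun _ => by positivity)]
  exact lintegral_congr fun w => by rw [ENNReal.ofReal_pow (norm_nonneg _), ofReal_norm]

lemma W2sq_map_le {Ω F : Type*} [MeasurableSpace Ω] [MeasurableSpace F] [NormedAddCommGroup F]
    [BorelSpace F] [SecondCountableTopology F]
    {P : Measure Ω} {X Y : Ω → F} (hX : AEMeasurable X P) (hY : AEMeasurable Y P) :
    W2sq (P.map X) (P.map Y) ≤ ∫⁻ w, ‖X w - Y w‖ₑ ^ 2 ∂P := by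
  have hXY := hX.prodMk hY
  have hplan : P.map (fun w => (X w, Y w)) ∈ plans (P.map X) (P.map Y) := by
    constructor
    · rw [AEMeasurable.map_map_of_aemeasurable measurable_fst.aemeasurable hXY]; rfl
    · rw [AEMeasurable.map_map_of_aemeasurable measurable_snd.aemeasurable hXY]; rfl
  refine (iInf₂_le _ hplan).trans_eq ?_
  rw [lintegral_map' (Measurable.aemeasurable (by fun_prop)) hXY]
  simp only [edist_eq_enorm_sub]

lemma integral_norm_sub_sq {Ω H : Type*} [MeasurableSpace Ω] [NormedAddCommGroup H]
    [InnerProductSpace ℝ H] {P : Measure Ω} {X Y : Ω → H} (hX : MemLp X 2 P) (hY : MemLp Y 2 P) :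
    ∫ w, ‖X w - Y w‖ ^ 2 ∂P =
      ∫ w, ‖X w‖ ^ 2 ∂P - 2 * ∫ w, inner ℝ (X w) (Y w) ∂P + ∫ w, ‖Y w‖ ^ 2 ∂P := by
  have i1 := hX.norm.integrable_sq
  have i2 := hY.norm.integrable_sq
  have i3 := (integrable_inner_of_memLp_two hX hY).const_mul 2
  simp_rw [norm_sub_sq_real]
  rw [← integral_const_mul, ← integral_sub i1 i3]
  exact integral_add (i1.sub i3) i2

/-- A Brenier map is an optimal transport map. -/
theorem IsBrenierMap.lintegral_le_W2sq {d : ℕ} {μ ν : Measure (E d)} [IsProbabilityMeasure μ]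
    (hμ2 : MemLp (fun x => x) 2 μ) {φ : E d → ℝ} {T : E d → E d} (hT : IsBrenierMap μ ν φ T)
    (hT2 : MemLp T 2 μ) : ∫⁻ x, ‖T x - x‖ₑ ^ 2 ∂μ ≤ W2sq μ ν := by
  obtain ⟨Ω, -, hΩ, hφ, hgrad⟩ := hT.exists_convex
  refine le_iInf₂ fun γ hγ => ?_
  have hfst : MeasurePreserving Prod.fst γ μ := ⟨measurable_fst, hγ.1⟩
  have : IsProbabilityMeasure γ := by
    have : IsProbabilityMeasure (γ.map Prod.fst) := hfst.map_eq ▸ inferInstance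
    exact Measure.isProbabilityMeasure_of_map Prod.fst
  have hX : MemLp (fun p : E d × E d => p.1) 2 γ := hμ2.comp_measurePreserving hfst
  have hTX : MemLp (fun p : E d × E d => T p.1) 2 γ := hT2.comp_measurePreserving hfst
  have hid : IdentDistrib (fun p : E d × E d => p.2) (fun p => T p.1) γ γ := by
    refine ⟨measurable_snd.aemeasurable, hTX.1.aemeasurable, ?_⟩
    have h := AEMeasurable.map_map_of_aemeasurable (μ := γ) (f := Prod.fst) (g := T)
      (by rw [hγ.1]; exact hT.aemeasurable) measurable_fst.aemeasurable
    rw [hγ.1, hT.map_eq] at h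
    exact hγ.2.trans h
  have hY : MemLp (fun p : E d × E d => p.2) 2 γ := hid.symm.memLp_snd hTX
  have hΩ' : ∀ᵐ x ∂μ, x ∈ Ω := mem_ae_iff.2 hΩ
  have hA : {p : E d × E d | p.1 ∈ Ω ∧ HasGradientAt φ (T p.1) p.1} ∈ ae γ :=
    hfst.quasiMeasurePreserving.ae (hΩ'.and hgrad)
  have hle := integral_inner_le_of_subgradient hX hTX hid hA (fun p => φ p.1)
    fun p hp q hq => add_inner_le_of_convexOn_of_hasGradientAt hφ hp.1 hq.1 hp.2
  have h1 := integral_norm_sub_sq hX hTX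
  have h2 := integral_norm_sub_sq hX hY
  have h3 : ∫ p, ‖p.2‖ ^ 2 ∂γ = ∫ p, ‖T p.1‖ ^ 2 ∂γ :=
    (hid.comp (u := fun y => ‖y‖ ^ 2) (by fun_prop)).integral_eq
  calc ∫⁻ x, ‖T x - x‖ₑ ^ 2 ∂μ = ∫⁻ x, ‖x - T x‖ₑ ^ 2 ∂μ := by simp_rw [enorm_sub_rev]
    _ = ∫⁻ p, ‖p.1 - T p.1‖ₑ ^ 2 ∂γ := by
      have := hT.aemeasurable
      rw [← hγ.1, lintegral_map' (by rw [hγ.1]; fun_prop) measurable_fst.aemeasurable]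
    _ = ENNReal.ofReal (∫ p, ‖p.1 - T p.1‖ ^ 2 ∂γ) := lintegral_enorm_sq (hX.sub hTX)
    _ ≤ ENNReal.ofReal (∫ p, ‖p.1 - p.2‖ ^ 2 ∂γ) := by
      apply ENNReal.ofReal_le_ofReal
      linarith
    _ = ∫⁻ p, edist p.1 p.2 ^ 2 ∂γ := by
      simp_rw [edist_eq_enorm_sub]
      exact (lintegral_enorm_sq (hX.sub hY)).symm

/-- Quantitative optimality of a `K`-Lipschitz monotone transport `t` on the line: the cost of a
coupling `(X, Y)` exceeds the optimal cost by at least `K⁻¹ E |Y - t(X)|²`, hence by at least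
`K⁻¹ E Var(Y | X)`. -/
theorem mul_W2sq_add_integral_condVar_le {Ω : Type*} [MeasurableSpace Ω] {P : Measure Ω}
    [IsProbabilityMeasure P] {X Y : Ω → ℝ} (hXm : Measurable X) (hX : MemLp X 2 P)
    (hY : MemLp Y 2 P) {t : ℝ → ℝ} (ht : IsMonotoneTransport (P.map X) (P.map Y) t) {K : ℝ≥0}
    (hK : essLip (P.map X) t < K) :
    K * W2sq (P.map X) (P.map Y) +
        ENNReal.ofReal (∫ w, condVar (MeasurableSpace.comap X inferInstance) Y P w ∂P) ≤
      K * ∫⁻ w, ‖Y w - X w‖ₑ ^ 2 ∂P := by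
  obtain ⟨K', ⟨s', hs', hlip⟩, hK'⟩ : ∃ K' : ℝ≥0, (∃ s ∈ ae (P.map X), LipschitzOnWith K' t s) ∧
      K' < K := by
    simpa [essLip, iInf_lt_iff] using hK
  have hK0 : 0 < K := bot_lt_of_lt hK'
  obtain ⟨s, hs, hmono⟩ := ht.monotoneOn
  obtain ⟨ψ, hψ⟩ := exists_potential_of_monotoneOn_lipschitzOnWith hK0
    (hmono.mono inter_subset_left) ((hlip.weaken hK'.le).mono inter_subset_right)
  let Z : Ω → ℝ := fun w => t (X w)
  have hid : IdentDistrib Y Z P P :=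
    ⟨hY.1.aemeasurable, ht.aemeasurable.comp_measurable hXm, by
      rw [← ht.map_eq, AEMeasurable.map_map_of_aemeasurable ht.aemeasurable hXm.aemeasurable]
      rfl⟩
  have hZ : MemLp Z 2 P := hid.memLp_snd hY
  have hW : MemLp (fun w => K * X w - Z w) 2 P := (hX.const_mul (K : ℝ)).sub hZ
  have hA : X ⁻¹' (s ∩ s') ∈ ae P := mem_ae_of_mem_ae_map hXm.aemeasurable (inter_mem hs hs')
  have hle := integral_inner_le_of_subgradient hW hZ hid hA (fun w => ψ (X w))
    fun w hw w' hw' => by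
      simpa [Z, mul_comm] using hψ (X w) hw (X w') hw'
  have iXY := integrable_inner_of_memLp_two hX hY
  have iXZ := integrable_inner_of_memLp_two hX hZ
  have iZY := integrable_inner_of_memLp_two hZ hY
  have iZZ := integrable_inner_of_memLp_two hZ hZ
  have expand : ∀ V : Ω → ℝ, Integrable (fun w => inner ℝ (X w) (V w)) P →
      Integrable (fun w => inner ℝ (Z w) (V w)) P →
      ∫ w, inner ℝ (K * X w - Z w) (V w) ∂P =
        K * ∫ w, inner ℝ (X w) (V w) ∂P - ∫ w, inner ℝ (Z w) (V w) ∂P := fun V h1 h2 => by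
    rw [← integral_const_mul, ← integral_sub (h1.const_mul _) h2]
    refine integral_congr_ae (ae_of_all _ fun w => ?_)
    simp only [RCLike.inner_apply, conj_trivial]
    ring
  rw [expand Y iXY iZY, expand Z iXZ iZZ] at hle
  have h1 := integral_norm_sub_sq hZ hX
  have h2 := integral_norm_sub_sq hY hX
  have h3 := integral_norm_sub_sq hZ hY
  have h4 : ∫ w, ‖Y w‖ ^ 2 ∂P = ∫ w, ‖Z w‖ ^ 2 ∂P :=
    (hid.comp (u := fun y => ‖y‖ ^ 2) (by fun_prop)).integral_eq
  have h5 : ∫ w, inner ℝ (Z w) (Z w) ∂P = ∫ w, ‖Z w‖ ^ 2 ∂P := by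
    simp_rw [real_inner_self_eq_norm_sq]
  simp_rw [real_inner_comm] at h1 h2
  have hreal : K * ∫ w, ‖Z w - X w‖ ^ 2 ∂P + ∫ w, ‖Z w - Y w‖ ^ 2 ∂P ≤
      K * ∫ w, ‖Y w - X w‖ ^ 2 ∂P := by
    rw [h1, h2, h3, h4]
    linarith
  have hcv : ∫ w, condVar (MeasurableSpace.comap X inferInstance) Y P w ∂P ≤
      ∫ w, ‖Z w - Y w‖ ^ 2 ∂P := by
    refine (integral_condVar_le_integral_sub_sq hXm.comap_le hY hZ ?_).trans_eq ?_
    · refine ⟨fun w => ht.aemeasurable.mk t (X w), ?_, ?_⟩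
      · exact (ht.aemeasurable.measurable_mk.comp (comap_measurable X)).stronglyMeasurable
      · exact ae_of_ae_map hXm.aemeasurable ht.aemeasurable.ae_eq_mk
    · refine integral_congr_ae (ae_of_all _ fun w => ?_)
      simp only [Real.norm_eq_abs, sq_abs]
      ring
  have hW2 : W2sq (P.map X) (P.map Y) ≤ ∫⁻ w, ‖Z w - X w‖ₑ ^ 2 ∂P := by
    rw [hid.map_eq]
    refine (W2sq_map_le hXm.aemeasurable hZ.1.aemeasurable).trans_eq ?_
    simp_rw [enorm_sub_rev]
  have hKr : (K : ℝ≥0∞) = ENNReal.ofReal K := (ENNReal.ofReal_coe_nnreal).symm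
  calc _ ≤ K * ∫⁻ w, ‖Z w - X w‖ₑ ^ 2 ∂P + ENNReal.ofReal (∫ w, ‖Z w - Y w‖ ^ 2 ∂P) := by gcongr
    _ = ENNReal.ofReal (K * ∫ w, ‖Z w - X w‖ ^ 2 ∂P + ∫ w, ‖Z w - Y w‖ ^ 2 ∂P) := by
      rw [lintegral_enorm_sq (f := fun w => Z w - X w) (hZ.sub hX), hKr,
        ← ENNReal.ofReal_mul K.coe_nonneg,
        ← ENNReal.ofReal_add (mul_nonneg K.coe_nonneg (integral_nonneg fun _ => by positivity))
          (integral_nonneg fun _ => by positivity)]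
    _ ≤ ENNReal.ofReal (K * ∫ w, ‖Y w - X w‖ ^ 2 ∂P) := ENNReal.ofReal_le_ofReal hreal
    _ = _ := by
      rw [ENNReal.ofReal_mul K.coe_nonneg, ← hKr,
        lintegral_enorm_sq (f := fun w => Y w - X w) (hY.sub hX)]

/-! ### Ridge defect and sliced Wasserstein deficit -/

lemma measurable_proj {d : ℕ} (θ : S d) : Measurable (proj θ) := by
  unfold proj
  fun_prop

lemma ridgeDefect_congr {d : ℕ} {μ : Measure (E d)} {u v : E d → E d} (h : u =ᵐ[μ] v) :
    ridgeDefect μ u = ridgeDefect μ v := by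
  refine lintegral_congr fun θ => congrArg _ (integral_congr_ae (condVar_congr_ae ?_))
  filter_upwards [h] with x hx
  rw [hx]

/-- Averaging the one-dimensional costs of a map over the directions. -/
lemma lintegral_lintegral_enorm_proj_sub_sq {d : ℕ} [NeZero d] {μ : Measure (E d)} [SFinite μ]
    {T : E d → E d} (hT : AEMeasurable T μ) :
    ∫⁻ θ, ∫⁻ x, ‖proj θ (T x) - proj θ x‖ₑ ^ 2 ∂μ ∂(sphereMeasure d) =
      (d : ℝ≥0∞)⁻¹ * ∫⁻ x, ‖T x - x‖ₑ ^ 2 ∂μ := by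
  have hsub : ∀ (θ : S d) x, proj θ (T x) - proj θ x = proj θ (T x - x) := fun θ x =>
    (inner_sub_right _ _ _).symm
  simp_rw [hsub]
  rw [lintegral_lintegral_swap]
  · simp_rw [lintegral_enorm_proj_sq]
    exact lintegral_const_mul'' _ ((hT.sub aemeasurable_id).enorm.pow_const 2)
  · have h1 : AEMeasurable (fun p : S d × E d => T p.2) ((sphereMeasure d).prod μ) :=
      hT.comp_quasiMeasurePreserving Measure.quasiMeasurePreserving_snd
    have h2 : AEMeasurable (fun p : S d × E d => (p.1 : E d)) ((sphereMeasure d).prod μ) :=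
      (measurable_subtype_coe.comp measurable_fst).aemeasurable
    exact ((h2.inner (h1.sub measurable_snd.aemeasurable)).enorm.pow_const 2)

/-- The deficit controls the ridge defect of the Brenier map, if the one-dimensional transport maps
are `K`-Lipschitz in almost every direction. The deficit is written without subtraction. -/
theorem mul_SW2sq_add_ridgeDefect_le {d : ℕ} [NeZero d] {μ ν : Measure (E d)}
    [IsProbabilityMeasure μ] (hμ2 : MemLp (fun x => x) 2 μ) {φ : E d → ℝ} {T : E d → E d}
    (hT : IsBrenierMap μ ν φ T) (hT2 : MemLp T 2 μ) {τ : S d → ℝ → ℝ}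
    (hτ : ∀ᵐ θ ∂(sphereMeasure d), IsMonotoneTransport (slice μ θ) (slice ν θ) (τ θ))
    {K : ℝ≥0} (hK : ∀ᵐ θ ∂(sphereMeasure d), essLip (slice μ θ) (τ θ) < K) :
    K * SW2sq μ ν + ridgeDefect μ T ≤ K * ((d : ℝ≥0∞)⁻¹ * W2sq μ ν) := by
  calc K * SW2sq μ ν + ridgeDefect μ T
      ≤ ∫⁻ θ, K * W2sq (slice μ θ) (slice ν θ) ∂(sphereMeasure d) + ridgeDefect μ T := by
        gcongr
        exact lintegral_const_mul_le _ _
    _ ≤ ∫⁻ θ, (K * W2sq (slice μ θ) (slice ν θ) + ENNReal.ofReal (∫ x, condVar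
          (MeasurableSpace.comap (proj θ) inferInstance) (fun y => proj θ (T y)) μ x ∂μ))
          ∂(sphereMeasure d) := le_lintegral_add _ _
    _ ≤ ∫⁻ θ, K * ∫⁻ x, ‖proj θ (T x) - proj θ x‖ₑ ^ 2 ∂μ ∂(sphereMeasure d) := by
        refine lintegral_mono_ae ?_
        filter_upwards [hτ, hK] with θ hτθ hKθ
        have hν : slice ν θ = μ.map fun x => proj θ (T x) := by
          rw [slice, ← hT.map_eq, AEMeasurable.map_map_of_aemeasurable
            (measurable_proj θ).aemeasurable hT.aemeasurable]
          rfl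
        rw [hν] at hτθ ⊢
        exact mul_W2sq_add_integral_condVar_le (measurable_proj θ) (hμ2.const_inner (θ : E d))
          (hT2.const_inner (θ : E d)) hτθ hKθ
    _ = K * ((d : ℝ≥0∞)⁻¹ * ∫⁻ x, ‖T x - x‖ₑ ^ 2 ∂μ) := by
        rw [lintegral_const_mul' _ _ ENNReal.coe_ne_top,
          lintegral_lintegral_enorm_proj_sub_sq hT.aemeasurable]
    _ ≤ K * ((d : ℝ≥0∞)⁻¹ * W2sq μ ν) := by
        gcongr
        exact hT.lintegral_le_W2sq hμ2 hT2

/-- The deficit is nonnegative, and `Λ` times the deficit bounds the ridge defect of the Brenier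
map, where `Λ` is the essential supremum of the Lipschitz constants of the monotone transports. -/
theorem ridgeDefect_le_mul_deficit {d : ℕ} [NeZero d] {μ ν : Measure (E d)}
    [IsProbabilityMeasure μ] (hμ2 : MemLp (fun x => x) 2 μ) {φ : E d → ℝ} {T : E d → E d}
    (hT : IsBrenierMap μ ν φ T) (hT2 : MemLp T 2 μ) {τ : S d → ℝ → ℝ}
    (hτ : ∀ᵐ θ ∂(sphereMeasure d), IsMonotoneTransport (slice μ θ) (slice ν θ) (τ θ))
    (hΛ : essSup (fun θ => essLip (slice μ θ) (τ θ)) (sphereMeasure d) < ⊤) :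
    0 ≤ deficit μ ν ∧ ridgeDefect μ T ≤ ENNReal.ofReal
      ((essSup (fun θ => essLip (slice μ θ) (τ θ)) (sphereMeasure d)).toReal * deficit μ ν) := by
  set Λ := essSup (fun θ => essLip (slice μ θ) (τ θ)) (sphereMeasure d)
  have hW : W2sq μ ν ≠ ⊤ := by
    have h : W2sq (μ.map fun x => x) (μ.map T) ≤ _ :=
      W2sq_map_le hμ2.1.aemeasurable hT.aemeasurable
    rw [Measure.map_id', hT.map_eq, lintegral_enorm_sq (f := fun x => x - T x) (hμ2.sub hT2)] at h
    exact ne_top_of_le_ne_top ENNReal.ofReal_ne_top h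
  have hd : (d : ℝ≥0∞)⁻¹ ≠ ⊤ := ENNReal.inv_ne_top.2 (Nat.cast_ne_zero.2 (NeZero.ne d))
  have key : ∀ K : ℝ≥0, Λ < K →
      0 ≤ deficit μ ν ∧ ridgeDefect μ T ≤ ENNReal.ofReal (K * deficit μ ν) := by
    intro K hK
    have hK0 : (0 : ℝ) < K := by exact_mod_cast (pos_of_gt hK : (0 : ℝ≥0∞) < K)
    have h := mul_SW2sq_add_ridgeDefect_le hμ2 hT hT2 hτ
      ((ENNReal.ae_le_essSup _).mono fun θ hθ => hθ.trans_lt hK)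
    have htop : K * ((d : ℝ≥0∞)⁻¹ * W2sq μ ν) ≠ ⊤ :=
      ENNReal.mul_ne_top ENNReal.coe_ne_top (ENNReal.mul_ne_top hd hW)
    have hsum : K * SW2sq μ ν + ridgeDefect μ T ≠ ⊤ := ne_top_of_le_ne_top htop h
    obtain ⟨h1, h2⟩ := ENNReal.add_ne_top.1 hsum
    have h3 := ENNReal.toReal_mono htop h
    rw [ENNReal.toReal_add h1 h2, ENNReal.toReal_mul, ENNReal.toReal_mul, ENNReal.toReal_mul,
      ENNReal.toReal_inv, ENNReal.toReal_natCast, ENNReal.coe_toReal] at h3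
    have h4 : (ridgeDefect μ T).toReal ≤ K * deficit μ ν := by
      rw [deficit, one_div]
      linarith
    exact ⟨nonneg_of_mul_nonneg_right (ENNReal.toReal_nonneg.trans h4) hK0,
      (ENNReal.le_ofReal_iff_toReal_le h2 (ENNReal.toReal_nonneg.trans h4)).2 h4⟩
  obtain ⟨K₀, hK₀⟩ := ENNReal.lt_iff_exists_nnreal_btwn.1 hΛ
  refine ⟨(key K₀ hK₀.1).1, ?_⟩
  -- `Λ` itself need not be attained, so it is approached from above.
  have hlim : Tendsto (fun K : ℝ≥0 => ENNReal.ofReal (K * deficit μ ν)) (𝓝[>] Λ.toNNReal)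
      (𝓝 (ENNReal.ofReal (Λ.toNNReal * deficit μ ν))) := by
    have : Continuous fun K : ℝ≥0 => ENNReal.ofReal (K * deficit μ ν) :=
      ENNReal.continuous_ofReal.comp (NNReal.continuous_coe.mul continuous_const)
    exact this.continuousWithinAt
  refine ge_of_tendsto hlim ?_
  filter_upwards [self_mem_nhdsWithin] with K hK
  refine (key K ?_).2
  rw [← ENNReal.coe_toNNReal hΛ.ne]
  exact_mod_cast hK

end SlicedPK

theorem theorem1p2 (d : ℕ) (hd : 1 ≤ d)
    (μ ν : Measure (SlicedPK.E d)) [IsProbabilityMeasure μ] [IsProbabilityMeasure ν]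
    (hμ2 : MemLp (fun x => x) 2 μ) (hν2 : MemLp (fun x => x) 2 ν)
    (hμ : μ ≪ volume)
    (φ : SlicedPK.E d → ℝ) (T : SlicedPK.E d → SlicedPK.E d)
    (hT : SlicedPK.IsBrenierMap μ ν φ T)
    (hTL2 : MemLp T 2 μ) (hTan : hTL2.toLp T ∈ SlicedPK.tangentSpace μ)
    (τ : SlicedPK.S d → ℝ → ℝ)
    (hτ : ∀ᵐ θ ∂(SlicedPK.sphereMeasure d),
      SlicedPK.IsMonotoneTransport (SlicedPK.slice μ θ) (SlicedPK.slice ν θ) (τ θ))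
    (Λ : ℝ≥0∞)
    (hΛ : Λ = essSup (fun θ => SlicedPK.essLip (SlicedPK.slice μ θ) (τ θ))
      (SlicedPK.sphereMeasure d))
    (hΛ_fin : Λ < ⊤)
    (hκ : 0 < SlicedPK.kappaSPK μ) :
    Metric.infDist (hTL2.toLp T) (SlicedPK.affineFields μ) ^ 2
        ≤ (Λ / SlicedPK.kappaSPK μ).toReal * SlicedPK.deficit μ ν ∧
    Metric.infDist (hTL2.toLp T) (SlicedPK.affineFields μ) ^ 2
        ≤ ((d : ℝ≥0∞) * Λ / SlicedPK.kappaSPKbar μ).toReal * SlicedPK.deficit μ ν := by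
  have : NeZero d := ⟨by omega⟩
  set u := hTL2.toLp T
  set δ := Metric.infDist u (SlicedPK.affineFields μ)
  set κ := SlicedPK.kappaSPK μ
  obtain ⟨hD, hR⟩ := SlicedPK.ridgeDefect_le_mul_deficit hμ2 hT hTL2 hτ (hΛ ▸ hΛ_fin)
  rw [← hΛ, ← SlicedPK.ridgeDefect_congr hTL2.coeFn_toLp] at hR
  have hbar : (d : ℝ≥0∞) * Λ / SlicedPK.kappaSPKbar μ = Λ / κ :=
    ENNReal.mul_div_mul_left _ _ (Nat.cast_ne_zero.2 (NeZero.ne d)) (ENNReal.natCast_ne_top d)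
  rw [hbar, and_self]
  rcases (Metric.infDist_nonneg : 0 ≤ δ).eq_or_lt with hδ | hδ
  · have hδ0 : δ = 0 := hδ.symm
    rw [hδ0, zero_pow two_ne_zero]
    exact mul_nonneg ENNReal.toReal_nonneg hD
  have hδ2 : 0 < δ ^ 2 := by positivity
  have hκR : κ ≤ SlicedPK.ridgeDefect μ u / ENNReal.ofReal (δ ^ 2) :=
    iInf_le_of_le u (iInf₂_le hTan hδ)
  have hκδ : κ * ENNReal.ofReal (δ ^ 2) ≤ ENNReal.ofReal (Λ.toReal * SlicedPK.deficit μ ν) :=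
    (ENNReal.mul_le_of_le_div hκR).trans hR
  -- A positive distance to the affine fields makes `T` a competitor, so that `κ` is finite.
  have hκ_top : κ ≠ ⊤ := by
    intro h
    rw [h, ENNReal.top_mul (ENNReal.ofReal_pos.2 hδ2).ne'] at hκδ
    exact ENNReal.ofReal_ne_top (top_le_iff.1 hκδ)
  have hκ' : 0 < κ.toReal := ENNReal.toReal_pos hκ.ne' hκ_top
  have hfin := ENNReal.toReal_mono ENNReal.ofReal_ne_top hκδ
  rw [ENNReal.toReal_mul, ENNReal.toReal_ofReal hδ2.le,
    ENNReal.toReal_ofReal (mul_nonneg ENNReal.toReal_nonneg hD)] at hfin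
  rw [ENNReal.toReal_div, div_mul_eq_mul_div, le_div_iff₀ hκ']
  linarith
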